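/- For $k\ge 1$ and $n\ge k$ let $\binom{[n]}{k}$ be the set of $k$-element subsets of $[n]=\{1,\dots,n\}$. The Johnson graph $J(n,k)$ has vertex set $\binom{[n]}{k}$, with $A,B$ adjacent iff $|A\cap B|=k-1$; the Kneser graph $K(n,k)$ has the same vertex set, with distinct $A,B$ adjacent iff $A\cap B=\emptyset$. For a graph $G$, the power $G^p$ has the same vertices, with $u,v$ adjacent iff $1\le d_G(u,v)\le p$, where $d_G$ is the graph distance; $\chi$ denotes the chromatic number. For $0\le i\le k$ let $$\mathcal E_i(x;n,k)=\sum_{t=0}^{i}(-1)^t\binom{x}{t}\binom{k-x}{i-t}\binom{n-k-x}{i-t}$$ be the Eberlein polynomials, where $\binom{a}{t}=a(a-1)\cdots(a-t+1)/t!$ for every integer $a$. For $n>2k$ and $0\le i\le k$ let $$\delta_{n,k}(i)=\min\left\{2\left\lceil\frac{i}{n-2k}\right\rceil,\;2\left\lceil\frac{k-i}{n-2k}\right\rceil+1\right\},\qquad \delta_{n,k}^{-1}([p])=\{\,0\le i\le k : 1\le\delta_{n,k}(i)\le p\,\}.$$ **Theorem 4.5.** Let $k\ge 1$. (i) For all $n\ge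 k$ one has $\mathrm{diam}(J(n,k))=\min\{k,n-k\}$, and for all $1\le p\le \min\{k,n-k\}$ $$\chi(J(n,k)^p)\;\ge\;1+\frac{\sum_{i=1}^p\binom ki\binom{n-k}i}{-\min\limits_{1\le j\le k}\sum_{i=1}^p\mathcal E_i(j;n,k)} .$$ The same bound holds with the minimum taken only over $1\le j\le\min\{k,n-k\}$ (which is the same minimum when $n\ge 2k$). (ii) For all $n>2k$ one has $\mathrm{diam}(K(n,k))=\left\lceil\frac{k-1}{n-2k}\right\rceil+1$, and for all $1\le p\le \left\lceil\frac{k-1}{n-2k}\right\rceil+1$ $$\chi(K(n,k)^p)\;\ge\;1+\frac{\sum_{i\in\delta_{n,k}^{-1}([p])}\binom ki\binom{n-k}i}{-\min\limits_{1\le j\le k}\sum_{i\in\delta_{n,k}^{-1}([p])}\mathcal E_i(j;n,k)} .$$ In each of these bounds the minimum in the denominator is negative. -/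

import Mathlib

/-- The `p`-th power of a graph: `u` and `v` are adjacent iff `1 ≤ d_G(u, v) ≤ p`.
(`SimpleGraph.dist` is `0` for vertices in different components, so these stay non-adjacent.) -/
def graphPower {V : Type*} (G : SimpleGraph V) (p : ℕ) : SimpleGraph V where
  Adj u v := 1 ≤ G.dist u v ∧ G.dist u v ≤ p
  symm := ⟨fun u v h => by rwa [SimpleGraph.dist_comm]⟩
  loopless := ⟨fun u h => by simp at h⟩

/-- The type of `k`-element subsets of an `n`-element set. -/
abbrev KSubset (n k : ℕ) : Type := {A : Finset (Fin n) // A.card = k}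

/-- The Johnson graph `J(n, k)`: two `k`-subsets are adjacent iff their intersection has `k - 1`
elements, written without truncated subtraction. -/
def johnsonGraph (n k : ℕ) : SimpleGraph (KSubset n k) where
  Adj A B := (A.1 ∩ B.1).card + 1 = k
  symm := ⟨fun A B h => by rwa [Finset.inter_comm]⟩
  loopless := ⟨fun A h => by
    rw [Finset.inter_self, A.2] at h
    omega⟩

/-- The Kneser graph `K(n, k)`: two distinct `k`-subsets are adjacent iff they are disjoint
(distinctness is automatic for `k ≥ 1`). -/
def kneserGraph (n k : ℕ) : SimpleGraph (KSubset n k) where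
  Adj A B := A ≠ B ∧ A.1 ∩ B.1 = ∅
  symm := ⟨fun A B h => ⟨h.1.symm, by rw [Finset.inter_comm]; exact h.2⟩⟩
  loopless := ⟨fun A h => h.1 rfl⟩

/-- The Eberlein polynomial `ℰ_i(x; n, k)` at an integer `x`. `Ring.choose a t` is the polynomial
binomial coefficient `a (a - 1) ⋯ (a - t + 1) / t!`, also for negative `a`. -/
def eberlein (i : ℕ) (x : ℤ) (n k : ℕ) : ℤ :=
  ∑ t ∈ Finset.range (i + 1),
    (-1) ^ t * Ring.choose x t * Ring.choose ((k : ℤ) - x) (i - t) *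
      Ring.choose ((n : ℤ) - k - x) (i - t)

/-- The minimum of `∑_{i ∈ S} ℰ_i(j; n, k)` over `1 ≤ j ≤ m`. -/
def minEberleinSum (S : Finset ℕ) (n k m : ℕ) (hm : 1 ≤ m) : ℤ :=
  (Finset.Icc 1 m).inf' (Finset.nonempty_Icc.2 hm) fun j => ∑ i ∈ S, eberlein i (j : ℤ) n k

/-- `δ_{n,k}(i) = min {2 ⌈i / (n - 2k)⌉, 2 ⌈(k - i) / (n - 2k)⌉ + 1}`, for `n > 2k` and `i ≤ k`. -/
def kneserDelta (n k i : ℕ) : ℕ :=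
  min (2 * ⌈(i : ℚ) / ((n : ℚ) - 2 * k)⌉₊) (2 * ⌈((k : ℚ) - i) / ((n : ℚ) - 2 * k)⌉₊ + 1)

/-- The preimage `δ_{n,k}⁻¹({1, …, p})`, a subset of `{0, 1, …, k}`. -/
def kneserDeltaPreimage (n k p : ℕ) : Finset ℕ :=
  (Finset.range (k + 1)).filter fun i => kneserDelta n k i ∈ Finset.Icc 1 p

/-! In both graphs the distance from A to B depends only on |A \ B|, so a power has as adjacency
matrix a sum, over some set S of indices, of the distance matrices A_i of the Johnson scheme.
Hoffman's ratio bound, applied to this matrix, gives the inequality once its eigenvalues are known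
to be the sums of ℰ_i(j) over S.

These eigenvalues need no explicit eigenspaces. For an eigenvector v of A_1, the vectors A_i v
satisfy a three-term recurrence that the numbers ℰ_i(j) also satisfy (`johnsonRecurrence_mulVec`,
`johnsonRecurrence_eberlein`). Both sequences vanish beyond m = min(k, n-k), which makes their
parameters roots of one polynomial of degree m + 1. The m + 1 distinct values belonging to j = 0,
..., m exhaust the roots, so A_i v = ℰ_i(j) v for a single j. An eigenbasis of A_1 then controls the
quadratic form.

Distances come from potentials: |A \ B| for Johnson, δ(|A \ B|) for Kneser. Along a Kneser edge BC,
the numbers i = |A \ B| and i' = |A \ C| satisfy k ≤ i + i' ≤ k + (n - 2k), and every such i'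
occurs. -/

open Matrix

/-! ### The three-term recurrence and its polynomials -/

/-- The three-term recurrence satisfied by the distance matrices of the Johnson scheme. -/
structure JohnsonRecurrence {M : Type*} [AddCommGroup M] [Module ℝ M] (k l θ : ℝ) (w : ℕ → M) :
    Prop where
  one : w 1 = θ • w 0
  add_two : ∀ i : ℕ, ((i : ℝ) + 2) ^ 2 • w (i + 2) +
    (((i : ℝ) + 1) * (k + l - 2 * (i + 1))) • w (i + 1) +
      ((k - i) * (l - i)) • w i = θ • w (i + 1)

/-- The monic orthogonal polynomials of the Johnson scheme. -/
noncomputable def johnsonPoly (k l : ℝ) : ℕ → Polynomial ℝ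
  | 0 => 1
  | 1 => Polynomial.X
  | i + 2 => (Polynomial.X - Polynomial.C (((i : ℝ) + 1) * (k + l - 2 * (i + 1)))) *
      johnsonPoly k l (i + 1) -
        Polynomial.C (((i : ℝ) + 1) ^ 2 * ((k - i) * (l - i))) * johnsonPoly k l i

theorem johnsonPoly_monic (k l : ℝ) (i : ℕ) :
    (johnsonPoly k l i).Monic ∧ (johnsonPoly k l i).natDegree = i := by
  induction i using Nat.twoStepInduction with
  | zero => simp [johnsonPoly]
  | one => simp [johnsonPoly, Polynomial.monic_X]
  | more i h0 h1 =>
    have hm : ((Polynomial.X - Polynomial.C (((i : ℝ) + 1) * (k + l - 2 * (i + 1)))) *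
      johnsonPoly k l (i + 1)).Monic := (Polynomial.monic_X_sub_C _).mul h1.1
    have hd : ((Polynomial.X - Polynomial.C (((i : ℝ) + 1) * (k + l - 2 * (i + 1)))) *
      johnsonPoly k l (i + 1)).natDegree = i + 2 := by
      rw [(Polynomial.monic_X_sub_C _).natDegree_mul h1.1, Polynomial.natDegree_X_sub_C, h1.2]
      omega
    have hs : (Polynomial.C (((i : ℝ) + 1) ^ 2 * ((k - i) * (l - i))) *
        johnsonPoly k l i).natDegree < i + 2 :=
      (Polynomial.natDegree_C_mul_le _ _).trans_lt (by omega)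
    have hlt := Polynomial.degree_lt_degree (hs.trans_eq hd.symm)
    refine ⟨hm.sub_of_left hlt, ?_⟩
    rw [johnsonPoly, Polynomial.natDegree_sub_eq_left_of_natDegree_lt (hs.trans_eq hd.symm), hd]

/-- Multiplying by (i!)² clears the leading coefficients (i + 2)². A solution is thus determined by
θ and w 0, with the same polynomial for scalar and for vector sequences. -/
theorem JohnsonRecurrence.factorial_smul {M : Type*} [AddCommGroup M] [Module ℝ M] {k l θ : ℝ}
    {w : ℕ → M} (h : JohnsonRecurrence k l θ w) (i : ℕ) :
    ((i.factorial : ℝ) ^ 2) • w i = (johnsonPoly k l i).eval θ • w 0 := by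
  induction i using Nat.twoStepInduction with
  | zero => simp [johnsonPoly]
  | one => simp [johnsonPoly, h.one]
  | more i h0 h1 =>
    have e : ((i : ℝ) + 2) ^ 2 • w (i + 2) =
        (θ - ((i : ℝ) + 1) * (k + l - 2 * (i + 1))) • w (i + 1) -
          ((k - i) * (l - i)) • w i := by
      rw [sub_smul, ← h.add_two i]; abel
    have e2 : (((i + 2).factorial : ℝ) ^ 2) =
        ((i + 1).factorial : ℝ) ^ 2 * ((i : ℝ) + 2) ^ 2 := by
      rw [Nat.factorial_succ (i + 1)]; push_cast; ring
    have e3 : (((i + 1).factorial : ℝ) ^ 2) = ((i : ℝ) + 1) ^ 2 * (i.factorial : ℝ) ^ 2 := by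
      rw [Nat.factorial_succ i]; push_cast; ring
    rw [e2, mul_smul, e, smul_sub, smul_comm _ _ (w (i + 1)), h1, e3, smul_smul _ _ (w i),
      mul_right_comm, mul_assoc, mul_smul, mul_comm ((k - i) * (l - i)), mul_smul,
      smul_comm _ _ (w i), h0, johnsonPoly]
    simp only [Polynomial.eval_sub, Polynomial.eval_mul, Polynomial.eval_X, Polynomial.eval_C,
      smul_smul, ← sub_smul]
    congr 1; ring

/-! ### Eberlein polynomials as solutions of the recurrence -/

/-- The Eberlein polynomial at a natural number `x`, in terms of `k - x` and `n - k - x`. -/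
def eberleinAux (K L x i : ℕ) : ℤ :=
  ∑ t ∈ Finset.range (i + 1),
    (-1) ^ t * (x.choose t : ℤ) * ((K.choose (i - t) : ℤ) * (L.choose (i - t) : ℤ))

theorem eberleinAux_zero_right (K L x : ℕ) : eberleinAux K L x 0 = 1 := by
  simp [eberleinAux]

theorem eberleinAux_zero (K L i : ℕ) :
    eberleinAux K L 0 i = (K.choose i : ℤ) * (L.choose i : ℤ) := by
  rw [eberleinAux, Finset.sum_range_succ']
  simp

/-- Pascal's rule in x: with K and L fixed, the generating function in i is (1 - z)^x times a series
independent of x. -/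
theorem eberleinAux_succ (K L x i : ℕ) :
    eberleinAux K L (x + 1) (i + 1) = eberleinAux K L x (i + 1) - eberleinAux K L x i := by
  simp only [eberleinAux]
  rw [Finset.sum_range_succ' _ (i + 1), Finset.sum_range_succ' _ (i + 1), add_sub_right_comm,
    ← Finset.sum_sub_distrib]
  congr 1
  · refine Finset.sum_congr rfl fun t _ => ?_
    rw [Nat.choose_succ_succ, Nat.add_sub_add_right]
    push_cast
    ring
  · simp

theorem cast_succ_mul_choose_succ (K i : ℕ) :
    ((i : ℤ) + 1) * (K.choose (i + 1) : ℤ) = ((K : ℤ) - i) * (K.choose i : ℤ) := by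
  rcases le_or_gt i K with h | h
  · have := Nat.choose_succ_right_eq K i
    have h2 : ((K - i : ℕ) : ℤ) = (K : ℤ) - i := by omega
    rw [← h2]
    exact_mod_cast (by linarith : (i + 1) * K.choose (i + 1) = (K - i) * K.choose i)
  · rw [Nat.choose_eq_zero_of_lt h, Nat.choose_eq_zero_of_lt (by omega)]; simp

/-- Here k = K + x and l = L + x. Keeping K and L fixed lets the induction on x use
`eberleinAux_succ`: the relation for x + 1 is the difference of two consecutive relations for x. -/
theorem eberleinAux_recurrence (K L x : ℕ) :
    eberleinAux K L x 1 = (K * L - x) ∧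
    ∀ i : ℕ, ((i : ℤ) + 2) ^ 2 * eberleinAux K L x (i + 2) +
      ((i : ℤ) + 1) * (K + x + (L + x) - 2 * (i + 1)) * eberleinAux K L x (i + 1) +
        ((K + x - i) * (L + x - i)) * eberleinAux K L x i =
          (K * L - x) * eberleinAux K L x (i + 1) := by
  induction x with
  | zero =>
    refine ⟨by simp [eberleinAux_zero], fun i => ?_⟩
    simp only [eberleinAux_zero]
    have a1 := cast_succ_mul_choose_succ K i
    have a2 := cast_succ_mul_choose_succ K (i + 1)
    have b1 := cast_succ_mul_choose_succ L i
    have b2 := cast_succ_mul_choose_succ L (i + 1)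
    push_cast at *
    have e1 : ((i : ℤ) + 1) ^ 2 * (K.choose (i + 1) * L.choose (i + 1)) =
        (K - i) * (L - i) * (K.choose i * L.choose i) := by
      linear_combination ((i : ℤ) + 1) * L.choose (i + 1) * a1 + ((K : ℤ) - i) * K.choose i * b1
    have e2 : ((i : ℤ) + 2) ^ 2 * (K.choose (i + 2) * L.choose (i + 2)) =
        (K - (i + 1)) * (L - (i + 1)) * (K.choose (i + 1) * L.choose (i + 1)) := by
      linear_combination ((i : ℤ) + 2) * L.choose (i + 2) * a2 +
        ((K : ℤ) - (i + 1)) * K.choose (i + 1) * b2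
    linear_combination e2 - e1
  | succ x ih =>
    obtain ⟨h1, h2⟩ := ih
    refine ⟨?_, fun i => ?_⟩
    · rw [eberleinAux_succ, h1, eberleinAux_zero_right]; push_cast; ring
    · rcases i with _ | i
      · have := h2 0
        simp only [eberleinAux_succ, eberleinAux_zero_right, h1] at *
        push_cast at *
        linear_combination this
      · have r1 := h2 (i + 1)
        have r0 := h2 i
        simp only [eberleinAux_succ] at *
        push_cast at *
        linear_combination r1 - r0

theorem eberlein_eq_eberleinAux {n k j : ℕ} (hkn : k ≤ n) (hj : j ≤ min k (n - k)) (i : ℕ) :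
    eberlein i (j : ℤ) n k = eberleinAux (k - j) (n - k - j) j i := by
  have h1 : (k : ℤ) - j = ((k - j : ℕ) : ℤ) := by omega
  have h2 : (n : ℤ) - k - j = ((n - k - j : ℕ) : ℤ) := by omega
  simp only [eberlein, eberleinAux, h1, h2, Ring.choose_natCast, mul_assoc]

/-- The eigenvalues of the Johnson graph. -/
def johnsonEigenvalue (k l : ℝ) (j : ℕ) : ℝ := (k - j) * (l - j) - j

theorem johnsonRecurrence_eberlein {n k j : ℕ} (hkn : k ≤ n) (hj : j ≤ min k (n - k)) :
    JohnsonRecurrence (k : ℝ) ((n : ℝ) - k) (johnsonEigenvalue k ((n : ℝ) - k) j)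
      (fun i => (eberlein i (j : ℤ) n k : ℝ)) := by
  have h1 : ((k - j : ℕ) : ℝ) = (k : ℝ) - j := Nat.cast_sub (by omega)
  have h2 : ((n - k - j : ℕ) : ℝ) = (n : ℝ) - k - j := by
    rw [Nat.cast_sub (by omega), Nat.cast_sub hkn]
  obtain ⟨r1, r2⟩ := eberleinAux_recurrence (k - j) (n - k - j) j
  constructor
  · simp only [eberlein_eq_eberleinAux hkn hj, eberleinAux_zero_right, r1, smul_eq_mul,
      johnsonEigenvalue]
    push_cast
    rw [h1, h2]; ring
  · intro i
    have := congrArg (Int.cast (R := ℝ)) (r2 i)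
    push_cast at this
    rw [h1, h2] at this
    simp only [eberlein_eq_eberleinAux hkn hj, smul_eq_mul, johnsonEigenvalue]
    linear_combination this

theorem eberlein_zero_right {n k j : ℕ} : eberlein 0 (j : ℤ) n k = 1 := by
  simp [eberlein]

theorem eberlein_zero {n k : ℕ} (hkn : k ≤ n) (i : ℕ) :
    eberlein i ((0 : ℕ) : ℤ) n k = (k.choose i : ℤ) * ((n - k).choose i : ℤ) := by
  rw [eberlein_eq_eberleinAux hkn (Nat.zero_le _), eberleinAux_zero]; simp

theorem eberlein_eq_zero_of_lt {n k j i : ℕ} (hkn : k ≤ n) (hj : j ≤ min k (n - k))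
    (hi : min k (n - k) < i) : eberlein i (j : ℤ) n k = 0 := by
  rw [eberlein_eq_eberleinAux hkn hj, eberleinAux]
  refine Finset.sum_eq_zero fun t ht => ?_
  rcases lt_or_ge j t with h | h
  · simp [Nat.choose_eq_zero_of_lt h]
  · rcases le_total k (n - k) with h' | h'
    · rw [min_eq_left h'] at hi hj
      rw [Nat.choose_eq_zero_of_lt (by omega : k - j < i - t)]; simp
    · rw [min_eq_right h'] at hi hj
      rw [Nat.choose_eq_zero_of_lt (by omega : n - k - j < i - t)]; simp

theorem johnsonEigenvalue_injOn {n k : ℕ} (hkn : k ≤ n) :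
    Set.InjOn (johnsonEigenvalue k ((n : ℝ) - k)) (Finset.range (min k (n - k) + 1)) := by
  intro a ha b hb h
  simp only [Finset.coe_range, Set.mem_Iio] at ha hb
  have hn : (a : ℝ) + b ≤ n := by
    have : a + b ≤ n := by omega
    exact_mod_cast this
  simp only [johnsonEigenvalue] at h
  -- The second factor is positive, since a + b ≤ 2 min(k, n - k) ≤ n.
  have : ((a : ℝ) - b) * (n + 1 - (a + b)) = 0 := by linear_combination -h
  rcases mul_eq_zero.1 this with h | h
  · exact_mod_cast sub_eq_zero.1 h
  · linarith

/-- A nonzero solution of the recurrence that vanishes beyond `min k (n - k)` is a multiple of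
the sequence of Eberlein polynomials at some `j ≤ min k (n - k)`. -/
theorem JohnsonRecurrence.exists_eq_eberlein_smul {M : Type*} [AddCommGroup M] [Module ℝ M]
    {n k : ℕ} (hkn : k ≤ n) {θ : ℝ} {w : ℕ → M}
    (h : JohnsonRecurrence (k : ℝ) ((n : ℝ) - k) θ w) (hw : w 0 ≠ 0)
    (hz : w (min k (n - k) + 1) = 0) :
    ∃ j ≤ min k (n - k), θ = johnsonEigenvalue k ((n : ℝ) - k) j ∧
      ∀ i, w i = (eberlein i (j : ℤ) n k : ℝ) • w 0 := by
  set m := min k (n - k) with hm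
  have hroot : ∀ j ≤ m, (johnsonPoly k ((n : ℝ) - k) (m + 1)).eval
      (johnsonEigenvalue k ((n : ℝ) - k) j) = 0 := by
    intro j hj
    have := (johnsonRecurrence_eberlein hkn hj).factorial_smul (m + 1)
    simp only [eberlein_eq_zero_of_lt hkn hj (Nat.lt_succ_self m), eberlein_zero_right] at this
    simpa using this.symm
  have hθ : (johnsonPoly k ((n : ℝ) - k) (m + 1)).eval θ = 0 := by
    have := h.factorial_smul (m + 1)
    rw [hz, smul_zero] at this
    exact (smul_eq_zero.1 this.symm).resolve_right hw
  obtain ⟨hmon, hdeg⟩ := johnsonPoly_monic k ((n : ℝ) - k) (m + 1)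
  obtain ⟨j, hj, hjθ⟩ : ∃ j ≤ m, θ = johnsonEigenvalue k ((n : ℝ) - k) j := by
    -- Otherwise a monic polynomial of degree m + 1 would have m + 2 distinct roots.
    by_contra! hne
    set T := (Finset.range (m + 1)).image (johnsonEigenvalue k ((n : ℝ) - k)) with hT
    have hcard : T.card = m + 1 := by
      rw [hT, Finset.card_image_of_injOn (johnsonEigenvalue_injOn hkn), Finset.card_range]
    have hθT : θ ∉ T := by
      simp only [hT, Finset.mem_image, Finset.mem_range, not_exists, not_and]
      exact fun j hj e => hne j (by omega) e.symm
    refine hmon.ne_zero (Polynomial.eq_zero_of_natDegree_lt_card_of_eval_eq_zero' _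
      (insert θ T) ?_ ?_)
    · intro x hx
      rcases Finset.mem_insert.1 hx with rfl | hx
      · exact hθ
      · obtain ⟨j, hj, rfl⟩ := Finset.mem_image.1 hx
        exact hroot j (by simpa [Nat.lt_succ_iff] using hj)
    · rw [Finset.card_insert_of_notMem hθT, hcard, hdeg]; omega
  refine ⟨j, hj, hjθ, fun i => ?_⟩
  have h1 := h.factorial_smul i
  have h2 := (johnsonRecurrence_eberlein hkn hj).factorial_smul i
  simp only [eberlein_zero_right, Int.cast_one, smul_eq_mul, mul_one] at h2
  rw [hjθ, ← h2, mul_smul] at h1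
  exact smul_right_injective M (pow_ne_zero 2 (Nat.cast_ne_zero.2 i.factorial_ne_zero)) h1

/-! ### Hoffman's bound -/

/-- If every eigenvector of a real symmetric matrix `A` is an eigenvector of `B` with a nonnegative
eigenvalue, then the quadratic form of `B` is nonnegative. -/
theorem dotProduct_mulVec_nonneg_of_eigenvectors {V : Type*} [Fintype V] [DecidableEq V]
    {A B : Matrix V V ℝ} (hA : A.IsHermitian)
    (h : ∀ (v : V → ℝ) (θ : ℝ), v ≠ 0 → A *ᵥ v = θ • v → ∃ c : ℝ, 0 ≤ c ∧ B *ᵥ v = c • v)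
    (f : V → ℝ) : 0 ≤ f ⬝ᵥ (B *ᵥ f) := by
  set b := hA.eigenvectorBasis with hb
  have hbne : ∀ j, ((b j : EuclideanSpace ℝ V) : V → ℝ) ≠ 0 := by
    intro j h0
    have : b j = 0 := by ext x; exact congrFun h0 x
    have h1 := b.orthonormal.1 j
    rw [this, norm_zero] at h1
    exact zero_ne_one h1
  choose c hc0 hc using fun j => h _ _ (hbne j) (hA.mulVec_eigenvectorBasis j)
  have hT : ∀ j, Matrix.toEuclideanLin B (b j) = c j • b j := by
    intro j
    ext x
    exact congrFun (hc j) x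
  have key : f ⬝ᵥ (B *ᵥ f) =
      inner ℝ (WithLp.toLp 2 f) (Matrix.toEuclideanLin B (WithLp.toLp 2 f)) := by
    rw [EuclideanSpace.inner_eq_star_dotProduct, dotProduct_comm]
    rfl
  have hTf : Matrix.toEuclideanLin B (WithLp.toLp 2 f) =
      ∑ j, inner ℝ (b j) (WithLp.toLp 2 f) • c j • b j := by
    conv_lhs => rw [← b.sum_repr' (WithLp.toLp 2 f)]
    rw [map_sum]
    refine Finset.sum_congr rfl fun j _ => ?_
    rw [map_smul, hT]
  -- In the eigenbasis of A the form is the sum of c_j ⟨b_j, f⟩².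
  rw [key, hTf, inner_sum]
  refine Finset.sum_nonneg fun j _ => ?_
  rw [inner_smul_right, inner_smul_right, real_inner_comm (b j)]
  nlinarith [hc0 j, mul_self_nonneg (inner ℝ (b j) (WithLp.toLp 2 f)),
    mul_nonneg (hc0 j) (mul_self_nonneg (inner ℝ (b j) (WithLp.toLp 2 f)))]

/-- Hoffman's ratio bound for a weighted adjacency matrix with constant row sums. -/
theorem hoffman_chromatic_bound {V : Type*} [Fintype V] [DecidableEq V] [Nonempty V]
    (G : SimpleGraph V) (B : Matrix V V ℝ) (hsymm : B.IsSymm) (hdiag : ∀ u v, ¬ G.Adj u v → B u v = 0)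
    {D μ : ℝ} (hrow : B *ᵥ 1 = D • 1) (hμ : μ < 0)
    (hquad : ∀ f : V → ℝ, μ * (f ⬝ᵥ f) ≤ f ⬝ᵥ (B *ᵥ f)) :
    1 + D / (-μ) ≤ (G.chromaticNumber.toNat : ℝ) := by
  set N : ℝ := (Fintype.card V : ℝ) with hN
  have hNpos : 0 < N := by simp [hN, Fintype.card_pos]
  have hcol : G.Colorable G.chromaticNumber.toNat := by
    have := SimpleGraph.colorable_chromaticNumber (G.colorable_of_fintype)
    exact this
  obtain ⟨C⟩ := hcol
  set q := G.chromaticNumber.toNat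
  have h11 : (1 : V → ℝ) ⬝ᵥ 1 = N := by simp [dotProduct, hN]
  have hclass : ∀ c : Fin q, ((Finset.univ.filter fun v => C v = c).card : ℝ) * (D - μ) ≤ -μ * N := by
    intro c
    set f : V → ℝ := fun v => if C v = c then 1 else 0 with hf
    set a : ℝ := ((Finset.univ.filter fun v => C v = c).card : ℝ) with ha
    have hff : f ⬝ᵥ f = a := by
      simp only [dotProduct, hf, ha, mul_ite, mul_one, mul_zero, Finset.sum_ite]
      simp [Finset.filter_filter]
    have hf1 : f ⬝ᵥ 1 = a := by simp [dotProduct, hf, ha]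
    have hfB : f ⬝ᵥ (B *ᵥ f) = 0 := by
      simp only [dotProduct, mulVec]
      refine Finset.sum_eq_zero fun u _ => ?_
      by_cases hu : C u = c
      · rw [Finset.sum_eq_zero, mul_zero]
        intro v _
        by_cases hv : C v = c
        · rw [hdiag u v fun hadj => C.valid hadj (hu.trans hv.symm), zero_mul]
        · simp [hf, hv]
      · simp [hf, hu]
    have h1B : (1 : V → ℝ) ⬝ᵥ (B *ᵥ f) = D * a := by
      rw [dotProduct_mulVec, ← mulVec_transpose, hsymm.eq, hrow, smul_dotProduct, dotProduct_comm,
        hf1, smul_eq_mul]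
    have hB1 : f ⬝ᵥ (B *ᵥ 1) = D * a := by rw [hrow, dotProduct_smul, hf1, smul_eq_mul]
    have h1B1 : (1 : V → ℝ) ⬝ᵥ (B *ᵥ 1) = D * N := by
      rw [hrow, dotProduct_smul, h11, smul_eq_mul]
    have h1f : 1 ⬝ᵥ f = a := by rw [dotProduct_comm, hf1]
    obtain ⟨t, hat⟩ : ∃ t, a = t * N := ⟨a / N, (div_mul_cancel₀ _ hNpos.ne').symm⟩
    have ha0 : 0 ≤ t := nonneg_of_mul_nonneg_left (hat ▸ (Nat.cast_nonneg _ : 0 ≤ a)) hNpos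
    -- With t = a / N this is the projection of the class indicator orthogonal to the constants;
    -- independence of the class removes the term f ⬝ᵥ (B *ᵥ f).
    have h := hquad (f - t • 1)
    simp only [mulVec_sub, mulVec_smul, sub_dotProduct, dotProduct_sub, smul_dotProduct,
      dotProduct_smul, hff, hf1, hfB, h1B, hB1, h1B1, h11, h1f, smul_eq_mul, hat] at h
    rw [hat]
    -- A colour may be unused, so t = 0 is handled before cancelling t.
    rcases ha0.eq_or_lt with h0 | h0
    · rw [← h0]; nlinarith
    · refine le_of_mul_le_mul_left ?_ h0
      linarith
  have hsum : N = ∑ c : Fin q, ((Finset.univ.filter fun v => C v = c).card : ℝ) := by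
    rw [hN, ← Finset.card_univ, Finset.card_eq_sum_card_fiberwise (f := C) (t := Finset.univ)
      (fun _ _ => Finset.mem_coe.2 (Finset.mem_univ _))]
    push_cast
    rfl
  have hle : N * (D - μ) ≤ q * (-μ * N) := by
    calc N * (D - μ) = ∑ c : Fin q, ((Finset.univ.filter fun v => C v = c).card : ℝ) * (D - μ) := by
          rw [← Finset.sum_mul, ← hsum]
      _ ≤ ∑ _c : Fin q, (-μ * N) := Finset.sum_le_sum fun c _ => hclass c
      _ = q * (-μ * N) := by simp
  have h5 : D - μ ≤ q * (-μ) := le_of_mul_le_mul_left (by linarith) hNpos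
  have hμ' : 0 < -μ := by linarith
  have : 1 + D / (-μ) = (D - μ) / (-μ) := by
    rw [sub_eq_neg_add, add_div, div_self hμ'.ne']
  rw [this, div_le_iff₀ hμ']
  exact h5

/-! ### The Johnson scheme and its distance matrices -/

/-- The distance-`i` matrix of the Johnson graph. -/
def johnsonMatrix (n k i : ℕ) : Matrix (KSubset n k) (KSubset n k) ℝ :=
  Matrix.of fun A B => if (A.1 \ B.1).card = i then 1 else 0

theorem KSubset.card_sdiff_comm {n k : ℕ} (A B : KSubset n k) :
    (A.1 \ B.1).card = (B.1 \ A.1).card :=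
  Finset.card_sdiff_comm (A.2.trans B.2.symm)

theorem KSubset.card_inter_add {n k : ℕ} (A B : KSubset n k) :
    (A.1 ∩ B.1).card + (A.1 \ B.1).card = k := by
  rw [Finset.card_inter_add_card_sdiff, A.2]

theorem KSubset.card_union {n k : ℕ} (A B : KSubset n k) :
    (A.1 ∪ B.1).card = k + (A.1 \ B.1).card := by
  rw [A.card_sdiff_comm, ← Finset.union_sdiff_self_eq_union,
    Finset.card_union_of_disjoint Finset.disjoint_sdiff, A.2]

theorem KSubset.card_sdiff_le {n k : ℕ} (A B : KSubset n k) :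
    (A.1 \ B.1).card ≤ min k (n - k) := by
  have h1 := A.card_inter_add B
  have h2 := A.card_union B
  have h3 := card_finset_fin_le (A.1 ∪ B.1)
  omega

theorem KSubset.card_sdiff_eq_zero {n k : ℕ} (A B : KSubset n k) :
    (A.1 \ B.1).card = 0 ↔ A = B := by
  rw [Finset.card_eq_zero, Finset.sdiff_eq_empty_iff_subset]
  refine ⟨fun h => Subtype.ext (Finset.eq_of_subset_of_card_le h (by rw [A.2, B.2])), ?_⟩
  rintro rfl
  exact subset_rfl

theorem johnsonMatrix_isSymm (n k i : ℕ) : (johnsonMatrix n k i).IsSymm := by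
  ext A B
  simp [johnsonMatrix, A.card_sdiff_comm B]

theorem johnsonMatrix_zero (n k : ℕ) : johnsonMatrix n k 0 = 1 := by
  ext A B
  simp only [johnsonMatrix, Matrix.of_apply, KSubset.card_sdiff_eq_zero, Matrix.one_apply]

theorem johnsonMatrix_eq_zero {n k i : ℕ} (hi : min k (n - k) < i) : johnsonMatrix n k i = 0 := by
  ext A B
  have := A.card_sdiff_le B
  simp only [johnsonMatrix, Matrix.of_apply, Matrix.zero_apply]
  rw [if_neg (by omega)]

theorem card_insert_erase {n : ℕ} {B : Finset (Fin n)} {a b : Fin n} (hb : b ∈ B) (ha : a ∉ B) :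
    (insert a (B.erase b)).card = B.card := by
  rw [Finset.card_insert_of_notMem (by simp [ha]), Finset.card_erase_add_one hb]

theorem sdiff_insert_erase {n : ℕ} {B : Finset (Fin n)} {a b : Fin n} (hb : b ∈ B) (ha : a ∉ B) :
    B \ insert a (B.erase b) = {b} := by
  ext x
  simp only [Finset.mem_sdiff, Finset.mem_insert, Finset.mem_erase, Finset.mem_singleton]
  constructor
  · tauto
  · rintro rfl
    refine ⟨hb, ?_⟩
    rintro (rfl | h)
    · exact ha hb
    · exact h.1 rfl

theorem insert_erase_sdiff {n : ℕ} {B : Finset (Fin n)} {a b : Fin n} (ha : a ∉ B) :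
    insert a (B.erase b) \ B = {a} := by
  ext x
  simp only [Finset.mem_sdiff, Finset.mem_insert, Finset.mem_erase, Finset.mem_singleton]
  constructor
  · tauto
  · rintro rfl
    exact ⟨Or.inl rfl, ha⟩

/-- Summing over the neighbours of `B` in the Johnson graph is summing over all swaps. -/
theorem sum_johnson_neighbors {n k : ℕ} (B : KSubset n k) (g : Finset (Fin n) → ℝ) :
    ∑ C : KSubset n k, (if (C.1 \ B.1).card = 1 then g C.1 else 0) =
      ∑ b ∈ B.1, ∑ a ∈ B.1ᶜ, g (insert a (B.1.erase b)) := by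
  rw [← Finset.sum_filter, ← Finset.sum_product']
  symm
  refine Finset.sum_bij
    (fun x hx => ⟨insert x.2 (B.1.erase x.1), by
      rw [Finset.mem_product, Finset.mem_compl] at hx
      rw [card_insert_erase hx.1 hx.2, B.2]⟩) ?_ ?_ ?_ ?_
  · intro x hx
    rw [Finset.mem_product, Finset.mem_compl] at hx
    rw [Finset.mem_filter]
    refine ⟨Finset.mem_univ _, ?_⟩
    rw [insert_erase_sdiff hx.2, Finset.card_singleton]
  · intro x hx y hy h
    rw [Finset.mem_product, Finset.mem_compl] at hx hy
    have h' := congrArg Subtype.val h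
    simp only at h'
    have h1 := sdiff_insert_erase hx.1 hx.2
    rw [h', sdiff_insert_erase hy.1 hy.2] at h1
    have h2 := insert_erase_sdiff (b := x.1) hx.2
    rw [h', insert_erase_sdiff hy.2] at h2
    exact Prod.ext (Finset.singleton_inj.1 h1).symm (Finset.singleton_inj.1 h2).symm
  · intro C hC
    rw [Finset.mem_filter] at hC
    obtain ⟨a, ha⟩ := Finset.card_eq_one.1 hC.2
    obtain ⟨b, hb⟩ := Finset.card_eq_one.1 ((B.card_sdiff_comm C).trans hC.2)
    have ha' : ∀ x, x ∈ C.1 ∧ x ∉ B.1 ↔ x = a := fun x => by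
      rw [← Finset.mem_sdiff, ha, Finset.mem_singleton]
    have hb' : ∀ x, x ∈ B.1 ∧ x ∉ C.1 ↔ x = b := fun x => by
      rw [← Finset.mem_sdiff, hb, Finset.mem_singleton]
    refine ⟨(b, a), ?_, ?_⟩
    · rw [Finset.mem_product, Finset.mem_compl]
      exact ⟨((hb' b).2 rfl).1, ((ha' a).2 rfl).2⟩
    · apply Subtype.ext
      ext x
      simp only [Finset.mem_insert, Finset.mem_erase]
      have := ha' x
      have := hb' x
      tauto
  · intro x hx
    rfl

theorem card_sdiff_insert_erase {n : ℕ} (A : Finset (Fin n)) {B : Finset (Fin n)} {a b : Fin n}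
    (hb : b ∈ B) (ha : a ∉ B) :
    (A \ insert a (B.erase b)).card + (if a ∈ A then 1 else 0) =
      (A \ B).card + (if b ∈ A then 1 else 0) := by
  have hab : a ≠ b := fun h => ha (h ▸ hb)
  have h1 : (A \ insert a (B.erase b)) ∪ (A ∩ {a}) = (A \ B) ∪ (A ∩ {b}) := by
    ext x
    simp only [Finset.mem_sdiff, Finset.mem_insert, Finset.mem_erase, Finset.mem_union,
      Finset.mem_inter, Finset.mem_singleton]
    by_cases hxa : x = a
    · subst hxa; simp [ha, hab]
    · by_cases hxb : x = b
      · subst hxb; simp +contextual [hxa]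
      · simp [hxa, hxb]
  have h2 : Disjoint (A \ insert a (B.erase b)) (A ∩ {a}) := by
    rw [Finset.disjoint_left]; intro x; simp; tauto
  have h3 : Disjoint (A \ B) (A ∩ {b}) := by
    rw [Finset.disjoint_left]; intro x hx hx'
    simp only [Finset.mem_sdiff, Finset.mem_inter, Finset.mem_singleton] at hx hx'
    exact hx.2 (hx'.2 ▸ hb)
  have h4 : ∀ c : Fin n, (A ∩ {c}).card = if c ∈ A then 1 else 0 := by
    intro c
    split_ifs with h
    · rw [Finset.inter_singleton_of_mem h, Finset.card_singleton]
    · rw [Finset.inter_singleton_of_notMem h, Finset.card_empty]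
  rw [← h4, ← h4, ← Finset.card_union_of_disjoint h2, ← Finset.card_union_of_disjoint h3, h1]

/-- The entry counts swaps of b ∈ B for a ∉ B that bring |A \ B| from r to i. The change is -1, 0 or
1 according to whether a and b lie in A; the four cases have sizes given by `c1` to `c4`. -/
theorem johnsonMatrix_mul_one_apply {n k : ℕ} (i : ℕ) (A B : KSubset n k) {r : ℕ}
    (hr : (A.1 \ B.1).card = r) :
    (johnsonMatrix n k i * johnsonMatrix n k 1) A B =
      (r : ℝ) * (n - 2 * r) * (if r = i then 1 else 0) +
        ((k : ℝ) - r) * (n - k - r) * (if r + 1 = i then 1 else 0) +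
          (r : ℝ) ^ 2 * (if r = i + 1 then 1 else 0) := by
  have hφ : ∀ b ∈ B.1, ∀ a ∈ B.1ᶜ,
      (if (A.1 \ insert a (B.1.erase b)).card = i then (1 : ℝ) else 0) =
        if b ∈ A.1 then (if a ∈ A.1 then (if r = i then 1 else 0) else if r + 1 = i then 1 else 0)
        else (if a ∈ A.1 then (if r = i + 1 then 1 else 0) else if r = i then 1 else 0) := by
    intro b hb a ha
    have h := card_sdiff_insert_erase A.1 hb (Finset.mem_compl.1 ha)
    rw [hr] at h
    split_ifs at h ⊢ <;> first | rfl | omega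
  have c1 : (B.1.filter (· ∈ A.1)).card + r = k := by
    have := A.card_inter_add B
    rw [Finset.filter_mem_eq_inter, Finset.inter_comm, ← hr]; exact this
  have c2 : (B.1.filter (· ∉ A.1)).card = r := by
    rw [Finset.filter_notMem_eq_sdiff, ← A.card_sdiff_comm, hr]
  have c3 : (B.1ᶜ.filter (· ∈ A.1)).card = r := by
    rw [Finset.filter_mem_eq_inter, Finset.inter_comm, ← Finset.sdiff_eq_inter_compl, hr]
  have c4 : (B.1ᶜ.filter (· ∉ A.1)).card + (k + r) = n := by
    rw [Finset.filter_notMem_eq_sdiff, ← hr, ← A.card_union B, Finset.sdiff_eq_inter_compl,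
      ← Finset.compl_union, Finset.union_comm, Finset.card_compl_add_card, Fintype.card_fin]
  have d1 : ((B.1.filter (· ∈ A.1)).card : ℝ) = k - r := by
    have := congrArg (Nat.cast (R := ℝ)) c1
    push_cast at this
    linarith
  have d4 : ((B.1ᶜ.filter (· ∉ A.1)).card : ℝ) = n - k - r := by
    have := congrArg (Nat.cast (R := ℝ)) c4
    push_cast at this
    linarith
  calc (johnsonMatrix n k i * johnsonMatrix n k 1) A B
      = ∑ C : KSubset n k, (if (C.1 \ B.1).card = 1 then
          (if (A.1 \ C.1).card = i then (1 : ℝ) else 0) else 0) := by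
        simp [Matrix.mul_apply, johnsonMatrix]
    _ = _ := sum_johnson_neighbors B fun C => if (A.1 \ C).card = i then (1 : ℝ) else 0
    _ = _ := Finset.sum_congr rfl fun b hb => Finset.sum_congr rfl fun a ha => hφ b hb a ha
    _ = _ := by
        have e : ∀ (b : Fin n) (x y z w : ℝ),
            (∑ a ∈ B.1ᶜ, if b ∈ A.1 then (if a ∈ A.1 then x else y) else
              (if a ∈ A.1 then z else w)) =
            if b ∈ A.1 then (r * x + ((n : ℝ) - k - r) * y) else (r * z + ((n : ℝ) - k - r) * w) := by
          intro b x y z w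
          split_ifs <;> rw [Finset.sum_ite, Finset.sum_const, Finset.sum_const, nsmul_eq_mul,
            nsmul_eq_mul, c3, d4]
        simp only [e]
        rw [Finset.sum_ite, Finset.sum_const, Finset.sum_const, nsmul_eq_mul, nsmul_eq_mul, c2, d1]
        ring

theorem johnsonRecurrence_mulVec {n k : ℕ} {v : KSubset n k → ℝ} {θ : ℝ}
    (hv : johnsonMatrix n k 1 *ᵥ v = θ • v) :
    JohnsonRecurrence (k : ℝ) ((n : ℝ) - k) θ (fun i => johnsonMatrix n k i *ᵥ v) := by
  constructor
  · simp only [johnsonMatrix_zero, one_mulVec, hv]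
  · intro i
    have h : johnsonMatrix n k (i + 1) * johnsonMatrix n k 1 =
        ((i : ℝ) + 2) ^ 2 • johnsonMatrix n k (i + 2) +
          (((i : ℝ) + 1) * (k + (n - k) - 2 * (i + 1))) • johnsonMatrix n k (i + 1) +
            (((k : ℝ) - i) * (n - k - i)) • johnsonMatrix n k i := by
      ext A B
      rw [johnsonMatrix_mul_one_apply _ _ _ rfl]
      simp only [johnsonMatrix, Matrix.add_apply, Matrix.smul_apply, Matrix.of_apply, smul_eq_mul]
      generalize (A.1 \ B.1).card = r
      by_cases h1 : r = i
      · subst h1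
        have : r ≠ r + 1 + 1 := by omega
        simp [this]
      · by_cases h2 : r = i + 1
        · subst h2; simp
        · by_cases h3 : r = i + 2
          · subst h3; simp
          · simp [h1, h2, h3]
    have h2 : θ • (johnsonMatrix n k (i + 1) *ᵥ v) =
        (johnsonMatrix n k (i + 1) * johnsonMatrix n k 1) *ᵥ v := by
      rw [← mulVec_mulVec, hv, mulVec_smul]
    rw [h2, h]
    simp only [add_mulVec, smul_mulVec]

theorem johnsonMatrix_mulVec_one {n k : ℕ} (hkn : k ≤ n) :
    johnsonMatrix n k 1 *ᵥ 1 = johnsonEigenvalue k ((n : ℝ) - k) (0 : ℕ) • (1 : KSubset n k → ℝ) := by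
  ext A
  have h := sum_johnson_neighbors A fun _ => 1
  have h2 : (johnsonMatrix n k 1 *ᵥ 1) A =
      ∑ C : KSubset n k, (if (C.1 \ A.1).card = 1 then (1 : ℝ) else 0) := by
    simp [mulVec, dotProduct, johnsonMatrix, A.card_sdiff_comm]
  rw [h2, h]
  simp [johnsonEigenvalue, A.2, Finset.card_compl, Nat.cast_sub hkn, mul_sub]

theorem KSubset.exists_card_sdiff_eq {n k i : ℕ} (hkn : k ≤ n) (hi : i ≤ min k (n - k)) :
    ∃ A B : KSubset n k, (A.1 \ B.1).card = i := by
  obtain ⟨A, -, hA⟩ := Finset.exists_subset_card_eq (s := (Finset.univ : Finset (Fin n))) (n := k)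
    (by simpa using hkn)
  obtain ⟨X, hX, hXc⟩ := Finset.exists_subset_card_eq (s := A) (n := k - i) (by omega)
  obtain ⟨Y, hY, hYc⟩ := Finset.exists_subset_card_eq (s := Aᶜ) (n := i) (by
    rw [Finset.card_compl, hA, Fintype.card_fin]; omega)
  have hdis : Disjoint A Y := Finset.disjoint_left.2 fun x hx hy => Finset.mem_compl.1 (hY hy) hx
  refine ⟨⟨A, hA⟩, ⟨X ∪ Y, ?_⟩, ?_⟩
  · rw [Finset.card_union_of_disjoint (hdis.mono_left hX), hXc, hYc]; omega
  · have : A \ (X ∪ Y) = A \ X := by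
      ext x
      have : x ∈ A → x ∉ Y := fun h => Finset.disjoint_left.1 hdis h
      simp only [Finset.mem_sdiff, Finset.mem_union]; tauto
    simp only [this]
    rw [Finset.card_sdiff_of_subset hX, hA, hXc]; omega

/-! ### The chromatic bound for unions of classes -/

theorem minEberleinSum_le {S : Finset ℕ} {n k m : ℕ} (hm : 1 ≤ m) {j : ℕ} (h1 : 1 ≤ j)
    (hj : j ≤ m) : minEberleinSum S n k m hm ≤ ∑ i ∈ S, eberlein i (j : ℤ) n k :=
  Finset.inf'_le _ (Finset.mem_Icc.2 ⟨h1, hj⟩)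

/-- The Hoffman bound for the unions of classes of the Johnson scheme. -/
theorem johnson_scheme_chromatic_bound {n k m : ℕ} (hkn : k ≤ n) (hm : 1 ≤ m)
    (hkm : min k (n - k) ≤ m) {S : Finset ℕ} (h0 : 0 ∉ S)
    (hS : ∃ i ∈ S, i ≤ min k (n - k)) {G : SimpleGraph (KSubset n k)}
    (hG : ∀ A B, G.Adj A B ↔ (A.1 \ B.1).card ∈ S) :
    minEberleinSum S n k m hm < 0 ∧
      1 + (∑ i ∈ S, (k.choose i : ℝ) * ((n - k).choose i : ℝ)) /
          (-(minEberleinSum S n k m hm : ℝ)) ≤ (G.chromaticNumber.toNat : ℝ) := by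
  set B : Matrix (KSubset n k) (KSubset n k) ℝ := ∑ i ∈ S, johnsonMatrix n k i with hB
  have hBapply : ∀ u v, B u v = if (u.1 \ v.1).card ∈ S then 1 else 0 := by
    intro u v
    simp [hB, Matrix.sum_apply, johnsonMatrix]
  have hsymm : B.IsSymm := by
    ext u v
    rw [Matrix.transpose_apply, hBapply, hBapply, u.card_sdiff_comm]
  have hvec : ∀ (v : KSubset n k → ℝ) (c : ℕ → ℝ), (∀ i, johnsonMatrix n k i *ᵥ v = c i • v) →
      B *ᵥ v = (∑ i ∈ S, c i) • v := by
    intro v c hc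
    rw [hB, Matrix.sum_mulVec, Finset.sum_smul]
    exact Finset.sum_congr rfl fun i _ => hc i
  obtain ⟨i₀, hi₀S, hi₀⟩ := hS
  obtain ⟨u, w, huw⟩ := KSubset.exists_card_sdiff_eq hkn hi₀
  have hone : (1 : KSubset n k → ℝ) ≠ 0 := fun h => one_ne_zero (congrFun h u)
  set D : ℝ := ∑ i ∈ S, (k.choose i : ℝ) * ((n - k).choose i : ℝ) with hD
  have hD0 : 0 ≤ D := Finset.sum_nonneg fun i _ => by positivity
  have hE0 : ((∑ i ∈ S, eberlein i ((0 : ℕ) : ℤ) n k : ℤ) : ℝ) = D := by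
    simp only [eberlein_zero hkn, hD]
    push_cast
    rfl
  have heig : ∀ (v : KSubset n k → ℝ) (θ : ℝ), v ≠ 0 → johnsonMatrix n k 1 *ᵥ v = θ • v →
      ∃ j ≤ min k (n - k), θ = johnsonEigenvalue k ((n : ℝ) - k) j ∧
        B *ᵥ v = ((∑ i ∈ S, eberlein i (j : ℤ) n k : ℤ) : ℝ) • v := by
    intro v θ hv h
    obtain ⟨j, hj, hθ, he⟩ := (johnsonRecurrence_mulVec h).exists_eq_eberlein_smul hkn
      (by simpa [johnsonMatrix_zero] using hv)
      (by simp [johnsonMatrix_eq_zero (Nat.lt_succ_self (min k (n - k)))])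
    refine ⟨j, hj, hθ, ?_⟩
    rw [Int.cast_sum]
    refine hvec v _ fun i => ?_
    simpa [johnsonMatrix_zero] using he i
  have hrow : B *ᵥ 1 = D • 1 := by
    obtain ⟨j, hj, hθ, he⟩ := heig 1 _ hone (johnsonMatrix_mulVec_one hkn)
    -- The row sum D is read off as the eigenvalue at j = 0, as distinct j have distinct
    -- A_1-eigenvalues.
    have : 0 = j := johnsonEigenvalue_injOn hkn (by simp) (by simpa [Nat.lt_succ_iff] using hj) hθ
    subst this
    rw [he, hE0]
  have hquad : ∀ μ : ℝ, μ ≤ D → (∀ j, 1 ≤ j → j ≤ min k (n - k) →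
      μ ≤ ((∑ i ∈ S, eberlein i (j : ℤ) n k : ℤ) : ℝ)) →
      ∀ f : KSubset n k → ℝ, μ * (f ⬝ᵥ f) ≤ f ⬝ᵥ (B *ᵥ f) := by
    intro μ hμD hμ f
    have hA : (johnsonMatrix n k 1).IsHermitian := by
      rw [Matrix.IsHermitian, Matrix.conjTranspose_eq_transpose_of_trivial]
      exact johnsonMatrix_isSymm n k 1
    have := dotProduct_mulVec_nonneg_of_eigenvectors (B := B - μ • (1 : Matrix _ _ ℝ)) hA ?_ f
    · simpa [sub_mulVec, smul_mulVec, dotProduct_sub] using this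
    · intro v θ hv h
      obtain ⟨j, hj, -, he⟩ := heig v θ hv h
      refine ⟨((∑ i ∈ S, eberlein i (j : ℤ) n k : ℤ) : ℝ) - μ, ?_, ?_⟩
      · rcases Nat.eq_zero_or_pos j with rfl | hj0
        · rw [hE0]; linarith
        · linarith [hμ j hj0 hj]
      · rw [sub_mulVec, he, smul_mulVec, one_mulVec, sub_smul]
  -- Indices j between min(k, n - k) and m need not give eigenvalues, but they can only lower the
  -- minimum, and any lower bound for the form suffices.
  have hmin : ∀ j, 1 ≤ j → j ≤ min k (n - k) →
      (minEberleinSum S n k m hm : ℝ) ≤ ((∑ i ∈ S, eberlein i (j : ℤ) n k : ℤ) : ℝ) :=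
    fun j h1 hj => Int.cast_le.2 (minEberleinSum_le hm h1 (hj.trans hkm))
  have hneg : minEberleinSum S n k m hm < 0 := by
    by_contra! hnn
    -- A nonnegative minimum would make B positive semidefinite, yet B has zero diagonal and u, w
    -- are adjacent, so the form is -2 at e_u - e_w.
    have h := hquad 0 hD0
      (fun j h1 hj => (Int.cast_nonneg hnn).trans (hmin j h1 hj)) (Pi.single u 1 - Pi.single w 1)
    have huu : B u u = 0 := by rw [hBapply]; simp [h0]
    have hww : B w w = 0 := by rw [hBapply]; simp [h0]
    have huw1 : B u w = 1 := by rw [hBapply, huw, if_pos hi₀S]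
    have hwu1 : B w u = 1 := by rw [hBapply, ← KSubset.card_sdiff_comm, huw, if_pos hi₀S]
    simp [mulVec_sub, sub_dotProduct, dotProduct_sub, huu, hww, huw1, hwu1] at h
    linarith
  have : Nonempty (KSubset n k) := ⟨u⟩
  refine ⟨hneg, hoffman_chromatic_bound G B hsymm ?_ hrow (Int.cast_lt_zero.2 hneg) ?_⟩
  · intro x y hxy
    rw [hBapply, if_neg (mt (hG x y).2 hxy)]
  · exact hquad _ ((Int.cast_lt_zero.2 hneg).le.trans hD0) hmin

/-! ### Distances and diameters from potentials; the Johnson graph -/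

/-- A function that changes by at most one along edges and can be decreased along some edge is the
distance to its zero. -/
theorem SimpleGraph.edist_eq_of_potential {V : Type*} {G : SimpleGraph V} {r : V → V → ℕ}
    (hr : ∀ u v, r u v = 0 ↔ u = v) (hle : ∀ u v w, G.Adj v w → r u w ≤ r u v + 1)
    (hlt : ∀ u v, u ≠ v → ∃ w, G.Adj v w ∧ r u w < r u v) (u v : V) :
    G.edist u v = r u v := by
  apply le_antisymm
  · have : ∀ d : ℕ, ∀ v, r u v ≤ d → G.edist u v ≤ d := by
      intro d
      induction d with
      | zero =>
        intro v h
        rw [(hr u v).1 (Nat.le_zero.1 h)]; simp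
      | succ d ih =>
        intro v h
        by_cases huv : u = v
        · rw [huv]; simp
        · obtain ⟨w, hw, hd⟩ := hlt u v huv
          calc G.edist u v ≤ G.edist u w + G.edist w v := G.edist_triangle
            _ ≤ d + 1 := add_le_add (ih w (by omega)) hw.symm.toWalk.edist_le
            _ = ((d + 1 : ℕ) : ℕ∞) := by push_cast; rfl
    exact this _ v le_rfl
  · refine le_iInf fun p => ?_
    rw [Nat.cast_le]
    have : ∀ a b (q : G.Walk a b), r u b ≤ r u a + q.length := by
      intro a b q
      induction q with
      | nil => simp
      | cons h q ih =>
        have := hle u _ _ h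
        rw [SimpleGraph.Walk.length_cons]; omega
    have h0 := (hr u u).2 rfl
    have := this u v p
    omega

theorem SimpleGraph.dist_eq_of_potential {V : Type*} {G : SimpleGraph V} {r : V → V → ℕ}
    (hr : ∀ u v, r u v = 0 ↔ u = v) (hle : ∀ u v w, G.Adj v w → r u w ≤ r u v + 1)
    (hlt : ∀ u v, u ≠ v → ∃ w, G.Adj v w ∧ r u w < r u v) (u v : V) :
    G.dist u v = r u v := by
  rw [SimpleGraph.dist, edist_eq_of_potential hr hle hlt, ENat.toNat_natCast]

theorem SimpleGraph.diam_eq_of_potential {V : Type*} {G : SimpleGraph V} {r : V → V → ℕ}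
    (hr : ∀ u v, r u v = 0 ↔ u = v) (hle : ∀ u v w, G.Adj v w → r u w ≤ r u v + 1)
    (hlt : ∀ u v, u ≠ v → ∃ w, G.Adj v w ∧ r u w < r u v) {d : ℕ} (hd : ∀ u v, r u v ≤ d)
    (hex : ∃ u v, d ≤ r u v) : G.diam = d := by
  obtain ⟨u, v, huv⟩ := hex
  have : G.ediam = d := by
    apply le_antisymm
    · refine SimpleGraph.ediam_le_of_edist_le fun a b => ?_
      rw [edist_eq_of_potential hr hle hlt]
      exact_mod_cast hd a b
    · refine le_trans ?_ (SimpleGraph.edist_le_ediam (u := u) (v := v))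
      rw [edist_eq_of_potential hr hle hlt]
      exact_mod_cast huv
  rw [SimpleGraph.diam, this, ENat.toNat_natCast]

theorem johnsonGraph_adj_iff {n k : ℕ} (A B : KSubset n k) :
    (johnsonGraph n k).Adj A B ↔ (A.1 \ B.1).card = 1 := by
  have := A.card_inter_add B
  change _ + 1 = k ↔ _
  omega

theorem johnson_potential_le {n k : ℕ} (A B C : KSubset n k) (h : (johnsonGraph n k).Adj B C) :
    (A.1 \ C.1).card ≤ (A.1 \ B.1).card + 1 := by
  rw [← (johnsonGraph_adj_iff B C).1 h]
  refine (Finset.card_le_card (t := A.1 \ B.1 ∪ B.1 \ C.1) fun x => ?_).trans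
    (Finset.card_union_le _ _)
  simp only [Finset.mem_sdiff, Finset.mem_union]
  tauto

theorem johnson_potential_lt {n k : ℕ} (A B : KSubset n k) (h : A ≠ B) :
    ∃ C, (johnsonGraph n k).Adj B C ∧ (A.1 \ C.1).card < (A.1 \ B.1).card := by
  have hpos : 0 < (A.1 \ B.1).card :=
    Nat.pos_of_ne_zero fun h0 => h ((A.card_sdiff_eq_zero B).1 h0)
  obtain ⟨a, ha⟩ := Finset.card_pos.1 hpos
  obtain ⟨b, hb⟩ := Finset.card_pos.1 (A.card_sdiff_comm B ▸ hpos)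
  rw [Finset.mem_sdiff] at ha hb
  refine ⟨⟨insert a (B.1.erase b), by rw [card_insert_erase hb.1 ha.2, B.2]⟩, ?_, ?_⟩
  · rw [johnsonGraph_adj_iff, sdiff_insert_erase hb.1 ha.2, Finset.card_singleton]
  · have := card_sdiff_insert_erase A.1 hb.1 ha.2
    rw [if_pos ha.1, if_neg hb.2] at this
    simp only
    omega

theorem johnsonGraph_dist {n k : ℕ} (A B : KSubset n k) :
    (johnsonGraph n k).dist A B = (A.1 \ B.1).card :=
  SimpleGraph.dist_eq_of_potential (r := fun A B : KSubset n k => (A.1 \ B.1).card)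
    KSubset.card_sdiff_eq_zero johnson_potential_le johnson_potential_lt A B

theorem johnsonGraph_diam {n k : ℕ} (hkn : k ≤ n) : (johnsonGraph n k).diam = min k (n - k) := by
  obtain ⟨A, B, h⟩ := KSubset.exists_card_sdiff_eq hkn le_rfl
  exact SimpleGraph.diam_eq_of_potential (r := fun A B : KSubset n k => (A.1 \ B.1).card)
    KSubset.card_sdiff_eq_zero johnson_potential_le johnson_potential_lt KSubset.card_sdiff_le
    ⟨A, B, h.ge⟩

/-! ### Distances in the Kneser graph -/

theorem natCeil_div_le_iff {a m q : ℕ} (hm : 0 < m) :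
    ⌈(a : ℚ) / (m : ℚ)⌉₊ ≤ q ↔ a ≤ q * m := by
  rw [Nat.ceil_le, div_le_iff₀ (by exact_mod_cast hm)]
  exact_mod_cast Iff.rfl

theorem kneserDelta_eq {n k i : ℕ} (hn : 2 * k < n) (hi : i ≤ k) :
    kneserDelta n k i = min (2 * ⌈(i : ℚ) / ((n - 2 * k : ℕ) : ℚ)⌉₊)
      (2 * ⌈((k - i : ℕ) : ℚ) / ((n - 2 * k : ℕ) : ℚ)⌉₊ + 1) := by
  rw [kneserDelta, Nat.cast_sub hn.le, Nat.cast_sub hi]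
  push_cast
  rfl

/-- Two Kneser steps move |A \ B| by at most n - 2k. Even walks start from the value 0, odd ones
from values at most n - 2k away from k after further pairs of steps; the two alternatives record
these ranges without ceilings. -/
theorem kneserDelta_le_iff {n k i q : ℕ} (hn : 2 * k < n) (hi : i ≤ k) :
    kneserDelta n k i ≤ q ↔
      i ≤ q / 2 * (n - 2 * k) ∨ 1 ≤ q ∧ k - i ≤ (q - 1) / 2 * (n - 2 * k) := by
  rw [kneserDelta_eq hn hi, min_le_iff, ← natCeil_div_le_iff (by omega),
    ← natCeil_div_le_iff (by omega)]
  omega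

theorem kneserDelta_eq_zero_iff {n k i : ℕ} (hn : 2 * k < n) (hi : i ≤ k) :
    kneserDelta n k i = 0 ↔ i = 0 := by
  rw [← Nat.le_zero, kneserDelta_le_iff hn hi]; simp

theorem kneserDelta_self {n k : ℕ} (hk : 1 ≤ k) (hn : 2 * k < n) : kneserDelta n k k = 1 := by
  have h1 : kneserDelta n k k ≤ 1 := by
    rw [kneserDelta_le_iff hn le_rfl]; simp
  have h2 := kneserDelta_eq_zero_iff hn (le_refl k)
  omega

/-- A step is the reflection i ↦ k - i followed by an increase of at most n - 2k, so it exchanges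
the even and odd alternatives. -/
theorem kneserDelta_le_succ {n k i i' : ℕ} (hn : 2 * k < n) (hi : i ≤ k) (hi' : i' ≤ k)
    (h1 : k ≤ i + i') (h2 : i + i' ≤ k + (n - 2 * k)) :
    kneserDelta n k i' ≤ kneserDelta n k i + 1 := by
  have h := (kneserDelta_le_iff hn hi).1 le_rfl
  generalize kneserDelta n k i = q at h
  rw [kneserDelta_le_iff hn hi']
  rcases h with h | ⟨hq, h⟩
  · right
    refine ⟨by omega, ?_⟩
    rw [Nat.add_sub_cancel]; omega
  · left
    have : (q + 1) / 2 = (q - 1) / 2 + 1 := by omega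
    rw [this, add_one_mul]; omega

theorem exists_kneserDelta_lt {n k i : ℕ} (hn : 2 * k < n) (hi : i ≤ k) (h0 : i ≠ 0) :
    ∃ i' ≤ k, k ≤ i + i' ∧ i + i' ≤ k + (n - 2 * k) ∧ kneserDelta n k i' < kneserDelta n k i := by
  have h := (kneserDelta_le_iff hn hi).1 le_rfl
  have hpos := mt (kneserDelta_eq_zero_iff hn hi).1 h0
  generalize kneserDelta n k i = q at h hpos
  rcases h with h | ⟨hq, h⟩
  · have hq2 : q / 2 ≠ 0 := by
      intro h'; rw [h', zero_mul] at h; omega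
    -- The largest admissible i'; truncated subtraction gives k when i ≤ n - 2k.
    refine ⟨k - (i - (n - 2 * k)), by omega, by omega, by omega, ?_⟩
    rw [← Nat.le_sub_one_iff_lt (by omega), kneserDelta_le_iff hn (by omega)]
    right
    refine ⟨by omega, ?_⟩
    have : (q - 1 - 1) / 2 = q / 2 - 1 := by omega
    rw [this, Nat.sub_one_mul]; omega
  · refine ⟨k - i, by omega, by omega, by omega, ?_⟩
    rw [← Nat.le_sub_one_iff_lt (by omega), kneserDelta_le_iff hn (by omega)]
    exact Or.inl h

theorem kneserDelta_le {n k i : ℕ} (hk : 1 ≤ k) (hn : 2 * k < n) (hi : i ≤ k) :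
    kneserDelta n k i ≤ ⌈((k : ℚ) - 1) / ((n : ℚ) - 2 * k)⌉₊ + 1 := by
  have e : ((k : ℚ) - 1) / ((n : ℚ) - 2 * k) = ((k - 1 : ℕ) : ℚ) / ((n - 2 * k : ℕ) : ℚ) := by
    rw [Nat.cast_sub hn.le, Nat.cast_sub hk]; push_cast; rfl
  rw [e]
  have h := (natCeil_div_le_iff (a := k - 1) (m := n - 2 * k) (by omega)).1 le_rfl
  generalize ⌈((k - 1 : ℕ) : ℚ) / ((n - 2 * k : ℕ) : ℚ)⌉₊ = Q at h
  rw [kneserDelta_le_iff hn hi, Nat.add_sub_cancel]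
  -- Otherwise i and k - i both exceed their ranges, and adding the two strict inequalities gives k
  -- ≥ Q(n - 2k) + 2.
  by_contra! hc
  have h1 := hc.1
  have h2 := hc.2 (by omega)
  have h3 : Q = (Q + 1) / 2 + Q / 2 := by omega
  rw [h3, add_mul] at h
  omega

theorem exists_le_kneserDelta {n k : ℕ} (hk : 1 ≤ k) (hn : 2 * k < n) :
    ∃ i ≤ k, ⌈((k : ℚ) - 1) / ((n : ℚ) - 2 * k)⌉₊ + 1 ≤ kneserDelta n k i := by
  have e : ((k : ℚ) - 1) / ((n : ℚ) - 2 * k) = ((k - 1 : ℕ) : ℚ) / ((n - 2 * k : ℕ) : ℚ) := by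
    rw [Nat.cast_sub hn.le, Nat.cast_sub hk]; push_cast; rfl
  rw [e]
  have h := fun q => natCeil_div_le_iff (a := k - 1) (m := n - 2 * k) (q := q) (by omega)
  generalize ⌈((k - 1 : ℕ) : ℚ) / ((n - 2 * k : ℕ) : ℚ)⌉₊ = Q at h
  rcases Nat.eq_zero_or_pos Q with rfl | hQ
  · exact ⟨k, le_rfl, (kneserDelta_self hk hn).ge⟩
  have h1 : (Q - 1) * (n - 2 * k) < k - 1 := by
    by_contra! hc
    have := (h (Q - 1)).2 hc
    omega
  have h2 : Q - 1 = Q / 2 + (Q - 1) / 2 := by omega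
  rw [h2, add_mul] at h1
  -- The first value out of reach of even walks of length at most Q; by `h1` it is also out of reach
  -- of odd ones.
  refine ⟨Q / 2 * (n - 2 * k) + 1, by omega, ?_⟩
  rw [Nat.succ_le_iff, ← not_le, kneserDelta_le_iff hn (by omega)]
  omega

/-- A ∩ B and A ∩ C are disjoint inside A, which gives the lower bound; at most n - 2k points of A
lie outside B ∪ C, which gives the upper one. -/
theorem kneserGraph_adj_card {n k : ℕ} (hn : 2 * k < n) {B C : KSubset n k}
    (h : (kneserGraph n k).Adj B C) (A : KSubset n k) :
    k ≤ (A.1 \ B.1).card + (A.1 \ C.1).card ∧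
      (A.1 \ B.1).card + (A.1 \ C.1).card ≤ k + (n - 2 * k) := by
  have hBC : Disjoint B.1 C.1 := Finset.disjoint_iff_inter_eq_empty.2 h.2
  have h1 : (A.1 ∩ B.1).card + (A.1 ∩ C.1).card ≤ k := by
    rw [← Finset.card_union_of_disjoint
      (hBC.mono Finset.inter_subset_right Finset.inter_subset_right),
      ← Finset.inter_union_distrib_left]
    exact (Finset.card_le_card Finset.inter_subset_left).trans A.2.le
  have h2 : (A.1 \ (B.1 ∪ C.1)).card + (k + k) ≤ n := by
    have hu : (B.1 ∪ C.1).card = k + k := by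
      rw [Finset.card_union_of_disjoint hBC, B.2, C.2]
    rw [← hu, ← Finset.card_union_of_disjoint Finset.sdiff_disjoint]
    exact card_finset_fin_le _
  have h3 : A.1.card ≤ (A.1 \ (B.1 ∪ C.1)).card + ((A.1 ∩ B.1).card + (A.1 ∩ C.1).card) := by
    refine (Finset.card_le_card (t := A.1 \ (B.1 ∪ C.1) ∪ (A.1 ∩ B.1 ∪ A.1 ∩ C.1))
      fun x hx => ?_).trans ((Finset.card_union_le _ _).trans
        (Nat.add_le_add_left (Finset.card_union_le _ _) _))
    simp only [Finset.mem_union, Finset.mem_sdiff, Finset.mem_inter]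
    tauto
  have h4 := A.card_inter_add B
  have h5 := A.card_inter_add C
  rw [A.2] at h3
  omega

/-- Converse of `kneserGraph_adj_card`: C takes k - i' points from A \ B and i' points outside A ∪
B, and the two inequalities say exactly that there is room. -/
theorem kneserGraph_exists_adj {n k : ℕ} (hk : 1 ≤ k) (hn : 2 * k < n) (A B : KSubset n k) {i' : ℕ}
    (hi' : i' ≤ k) (h1 : k ≤ (A.1 \ B.1).card + i')
    (h2 : (A.1 \ B.1).card + i' ≤ k + (n - 2 * k)) :
    ∃ C, (kneserGraph n k).Adj B C ∧ (A.1 \ C.1).card = i' := by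
  obtain ⟨X, hX, hXc⟩ := Finset.exists_subset_card_eq (s := A.1 \ B.1) (n := k - i') (by omega)
  obtain ⟨Y, hY, hYc⟩ := Finset.exists_subset_card_eq (s := (A.1 ∪ B.1)ᶜ) (n := i') (by
    rw [Finset.card_compl, A.card_union B, Fintype.card_fin]; omega)
  have hX' : ∀ x ∈ X, x ∈ A.1 ∧ x ∉ B.1 := fun x hx => Finset.mem_sdiff.1 (hX hx)
  have hY' : ∀ x ∈ Y, x ∉ A.1 ∧ x ∉ B.1 := fun x hx => by
    have := Finset.mem_compl.1 (hY hx)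
    rw [Finset.mem_union] at this; tauto
  have hXY : Disjoint X Y := Finset.disjoint_left.2 fun x hx hy => (hY' x hy).1 (hX' x hx).1
  have hC : (X ∪ Y).card = k := by
    rw [Finset.card_union_of_disjoint hXY, hXc, hYc]; omega
  have hdisj : B.1 ∩ (X ∪ Y) = ∅ := by
    ext x
    have := hX' x
    have := hY' x
    simp only [Finset.mem_inter, Finset.mem_union, Finset.notMem_empty]; tauto
  refine ⟨⟨X ∪ Y, hC⟩, ⟨?_, hdisj⟩, ?_⟩
  · rintro rfl
    simp only [Finset.inter_self] at hdisj
    rw [hdisj, Finset.card_empty] at hC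
    omega
  · have : A.1 \ (X ∪ Y) = A.1 \ X := by
      ext x
      have := hY' x
      simp only [Finset.mem_sdiff, Finset.mem_union]; tauto
    simp only [this]
    rw [Finset.card_sdiff_of_subset fun x hx => (hX' x hx).1, A.2, hXc]; omega

theorem KSubset.card_sdiff_le_left {n k : ℕ} (A B : KSubset n k) : (A.1 \ B.1).card ≤ k :=
  (A.card_sdiff_le B).trans (min_le_left _ _)

theorem kneser_potential_eq_zero {n k : ℕ} (hn : 2 * k < n) (A B : KSubset n k) :
    kneserDelta n k (A.1 \ B.1).card = 0 ↔ A = B := by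
  rw [kneserDelta_eq_zero_iff hn (A.card_sdiff_le_left B), A.card_sdiff_eq_zero]

theorem kneser_potential_le {n k : ℕ} (hn : 2 * k < n) (A B C : KSubset n k)
    (h : (kneserGraph n k).Adj B C) :
    kneserDelta n k (A.1 \ C.1).card ≤ kneserDelta n k (A.1 \ B.1).card + 1 := by
  obtain ⟨h1, h2⟩ := kneserGraph_adj_card hn h A
  exact kneserDelta_le_succ hn (A.card_sdiff_le_left B) (A.card_sdiff_le_left C) h1 h2

theorem kneser_potential_lt {n k : ℕ} (hk : 1 ≤ k) (hn : 2 * k < n) (A B : KSubset n k)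
    (h : A ≠ B) : ∃ C, (kneserGraph n k).Adj B C ∧
      kneserDelta n k (A.1 \ C.1).card < kneserDelta n k (A.1 \ B.1).card := by
  obtain ⟨i', hi', h1, h2, hlt⟩ := exists_kneserDelta_lt hn (A.card_sdiff_le_left B)
    (mt (A.card_sdiff_eq_zero B).1 h)
  obtain ⟨C, hC, rfl⟩ := kneserGraph_exists_adj hk hn A B hi' h1 h2
  exact ⟨C, hC, hlt⟩

theorem kneserGraph_dist {n k : ℕ} (hk : 1 ≤ k) (hn : 2 * k < n) (A B : KSubset n k) :
    (kneserGraph n k).dist A B = kneserDelta n k (A.1 \ B.1).card :=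
  SimpleGraph.dist_eq_of_potential (r := fun A B : KSubset n k => kneserDelta n k (A.1 \ B.1).card)
    (kneser_potential_eq_zero hn) (kneser_potential_le hn) (kneser_potential_lt hk hn) A B

theorem kneserGraph_diam {n k : ℕ} (hk : 1 ≤ k) (hn : 2 * k < n) :
    (kneserGraph n k).diam = ⌈((k : ℚ) - 1) / ((n : ℚ) - 2 * k)⌉₊ + 1 := by
  obtain ⟨i, hi, hle⟩ := exists_le_kneserDelta hk hn
  obtain ⟨A, B, rfl⟩ := KSubset.exists_card_sdiff_eq (n := n) (k := k) (i := i) (by omega)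
    (by omega)
  exact SimpleGraph.diam_eq_of_potential
    (r := fun A B : KSubset n k => kneserDelta n k (A.1 \ B.1).card)
    (kneser_potential_eq_zero hn) (kneser_potential_le hn) (kneser_potential_lt hk hn)
    (fun A B => kneserDelta_le hk hn (A.card_sdiff_le_left B)) ⟨A, B, hle⟩

/-! ### Powers as unions of classes, and the theorem -/

theorem graphPower_johnsonGraph_adj {n k p : ℕ} (A B : KSubset n k) :
    (graphPower (johnsonGraph n k) p).Adj A B ↔ (A.1 \ B.1).card ∈ Finset.Icc 1 p := by
  rw [Finset.mem_Icc, ← johnsonGraph_dist A B]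
  rfl

theorem graphPower_kneserGraph_adj {n k p : ℕ} (hk : 1 ≤ k) (hn : 2 * k < n) (A B : KSubset n k) :
    (graphPower (kneserGraph n k) p).Adj A B ↔
      (A.1 \ B.1).card ∈ kneserDeltaPreimage n k p := by
  have := A.card_sdiff_le_left B
  rw [kneserDeltaPreimage, Finset.mem_filter, Finset.mem_range, Finset.mem_Icc,
    ← kneserGraph_dist hk hn A B, and_iff_right (by omega)]
  rfl

theorem theorem4p5 (k : ℕ) (hk : 1 ≤ k) :
    (∀ n : ℕ, k ≤ n →
      (johnsonGraph n k).diam = min k (n - k) ∧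
      ∀ (p : ℕ) (hp : 1 ≤ p) (hpd : p ≤ min k (n - k)),
        (minEberleinSum (Finset.Icc 1 p) n k k hk < 0 ∧
          1 + (∑ i ∈ Finset.Icc 1 p, (k.choose i : ℝ) * ((n - k).choose i : ℝ)) /
              (-(minEberleinSum (Finset.Icc 1 p) n k k hk : ℝ)) ≤
            ((graphPower (johnsonGraph n k) p).chromaticNumber.toNat : ℝ)) ∧
        (minEberleinSum (Finset.Icc 1 p) n k (min k (n - k)) (hp.trans hpd) < 0 ∧
          1 + (∑ i ∈ Finset.Icc 1 p, (k.choose i : ℝ) * ((n - k).choose i : ℝ)) /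
              (-(minEberleinSum (Finset.Icc 1 p) n k (min k (n - k)) (hp.trans hpd) : ℝ)) ≤
            ((graphPower (johnsonGraph n k) p).chromaticNumber.toNat : ℝ))) ∧
    (∀ n : ℕ, 2 * k < n →
      (kneserGraph n k).diam = ⌈((k : ℚ) - 1) / ((n : ℚ) - 2 * k)⌉₊ + 1 ∧
      ∀ p : ℕ, 1 ≤ p → p ≤ ⌈((k : ℚ) - 1) / ((n : ℚ) - 2 * k)⌉₊ + 1 →
        minEberleinSum (kneserDeltaPreimage n k p) n k k hk < 0 ∧
          1 + (∑ i ∈ kneserDeltaPreimage n k p, (k.choose i : ℝ) * ((n - k).choose i : ℝ)) /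
              (-(minEberleinSum (kneserDeltaPreimage n k p) n k k hk : ℝ)) ≤
            ((graphPower (kneserGraph n k) p).chromaticNumber.toNat : ℝ)) := by
  refine ⟨fun n hkn => ⟨johnsonGraph_diam hkn, fun p hp hpd => ?_⟩,
    fun n hn => ⟨kneserGraph_diam hk hn, fun p hp _ => ?_⟩⟩
  · have h0 : 0 ∉ Finset.Icc 1 p := by simp
    have hS : ∃ i ∈ Finset.Icc 1 p, i ≤ min k (n - k) :=
      ⟨1, Finset.mem_Icc.2 ⟨le_rfl, hp⟩, hp.trans hpd⟩
    exact ⟨johnson_scheme_chromatic_bound hkn hk (min_le_left _ _) h0 hS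
        graphPower_johnsonGraph_adj,
      johnson_scheme_chromatic_bound hkn (hp.trans hpd) le_rfl h0 hS
        graphPower_johnsonGraph_adj⟩
  -- The class k always belongs to the preimage because δ(k) = 1 ≤ p, while δ(0) = 0 excludes the
  -- class 0.
  · refine johnson_scheme_chromatic_bound (by omega) hk (min_le_left _ _) ?_ ⟨k, ?_, by omega⟩
      (graphPower_kneserGraph_adj hk hn)
    · simp [kneserDeltaPreimage, (kneserDelta_eq_zero_iff hn (Nat.zero_le k)).2 rfl]
    · simp [kneserDeltaPreimage, kneserDelta_self hk hn, hp]
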